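/- Let $p$ be a prime, let $m \ge 1$ and $n \ge 3$ be integers, and let $\mathbb{F}_{p^m}$ be the field with $p^m$ elements. Let $\mathrm{UT}_n(\mathbb{F}_{p^m})$ be the group of lower unitriangular $n \times n$ matrices over $\mathbb{F}_{p^m}$ (ones on the diagonal, zeros above it), and put $G_n^{(m)} = \mathrm{UT}_n(\mathbb{F}_{p^m})/\gamma_3(\mathrm{UT}_n(\mathbb{F}_{p^m}))$, where $\gamma_1(H) = H$ and $\gamma_{k+1}(H) = [\gamma_k(H), H]$ is the lower central series of a group $H$. For a group $G$, let $\operatorname{Aut}_c(G)$ be the group of class preserving automorphisms of $G$, that is, of the automorphisms $\alpha$ such that $\alpha(x)$ is conjugate to $x$ in $G$ for every $x \in G$, let $\operatorname{Inn}(G) \le \operatorname{Aut}_c(G)$ be the group of inner automorphisms, and let $\operatorname{Out}_c(G) = \operatorname{Aut}_c(G)/\operatorname{Inn}(G)$. Then $\operatorname{Aut}_c(G_n^{(m)})$ is an elementary abelian $p$-group of order $p^{2m^2+mn-3m}$. Moreover, $\operatorname{Out}_c(G_n^{(m)})$ has order $p^{2m(m-1)}$, which is independent of $n$. -/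

import Mathlib

/-- The group `UT_n(K)` of lower unitriangular `n × n` matrices: ones on the diagonal, zeros above. -/
def lowerUnitriangular (n : ℕ) (K : Type*) [CommRing K] :
    Subgroup (Matrix.GeneralLinearGroup (Fin n) K) where
  carrier := {A | (∀ i, A i i = 1) ∧ ∀ i j, i < j → A i j = 0}
  one_mem' := by
    refine ⟨fun i => by simp, fun i j hij => ?_⟩
    simp [Matrix.one_apply, hij.ne]
  mul_mem' := by
    rintro A B ⟨hA1, hA0⟩ ⟨hB1, hB0⟩
    refine ⟨fun i => ?_, fun i j hij => ?_⟩
    · rw [Units.val_mul, Matrix.mul_apply, Finset.sum_eq_single i]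
      · rw [hA1, hB1, one_mul]
      · intro k _ hk
        rcases lt_or_gt_of_ne hk with h | h
        · rw [hB0 k i h, mul_zero]
        · rw [hA0 i k h, zero_mul]
      · simp
    · rw [Units.val_mul, Matrix.mul_apply]
      refine Finset.sum_eq_zero fun k _ => ?_
      rcases lt_or_ge i k with h | h
      · rw [hA0 i k h, zero_mul]
      · rw [hB0 k j (lt_of_le_of_lt h hij), mul_zero]
  inv_mem' := by
    rintro A ⟨hA1, hA0⟩
    have hInv : (A⁻¹.1 : Matrix (Fin n) (Fin n) K) = (A.1)⁻¹ := Matrix.coe_units_inv A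
    have hAt : Matrix.BlockTriangular A.1 OrderDual.toDual := fun i j hij => hA0 i j hij
    have hBt : Matrix.BlockTriangular (A⁻¹.1) OrderDual.toDual := by
      rw [hInv]
      haveI : Invertible A.1 := A.invertible
      exact Matrix.blockTriangular_inv_of_blockTriangular hAt
    have hB0 : ∀ i j, i < j → A⁻¹.1 i j = 0 := fun i j hij => hBt hij
    refine ⟨fun i => ?_, hB0⟩
    have h : (A.1 * A⁻¹.1) i i = 1 := by rw [← Units.val_mul]; simp
    rw [Matrix.mul_apply, Finset.sum_eq_single i] at h
    · rwa [hA1, one_mul] at h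
    · intro k _ hk
      rcases lt_or_gt_of_ne hk with h' | h'
      · rw [hB0 k i h', mul_zero]
      · rw [hA0 i k h', zero_mul]
    · simp

/-- The group `UT_n(K) / γ₃(UT_n(K))`; the lower central series of Mathlib starts at index `0`,
so that `γ₃` is its term of index `2`. -/
abbrev UTModGamma3 (n : ℕ) (K : Type*) [CommRing K] : Type _ :=
  lowerUnitriangular n K ⧸ (⊤ : Subgroup (lowerUnitriangular n K)).lowerCentralSeries 2

/-- The group `Aut_c(G)` of class preserving automorphisms: `α(x)` is conjugate to `x` for all `x`. -/
def classPreservingAut (G : Type*) [Group G] : Subgroup (MulAut G) where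
  carrier := {α | ∀ x : G, IsConj x (α x)}
  one_mem' := fun x => IsConj.refl x
  mul_mem' := fun {α β} hα hβ x => (hβ x).trans (hα (β x))
  inv_mem' := fun {α} hα x => by
    have h := hα (α⁻¹ x)
    rw [MulAut.apply_inv_self] at h
    exact h.symm

/-- The group `Inn(G)` of inner automorphisms. -/
def innerAut (G : Type*) [Group G] : Subgroup (MulAut G) := (MulAut.conj (G := G)).range

theorem innerAut_le_classPreservingAut (G : Type*) [Group G] :
    innerAut G ≤ classPreservingAut G := by
  rintro _ ⟨g, rfl⟩ x
  exact isConj_iff.2 ⟨g, rfl⟩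

instance innerAut_normal (G : Type*) [Group G] : (innerAut G).Normal where
  conj_mem := by
    rintro _ ⟨g, rfl⟩ α
    refine ⟨α g, ?_⟩
    ext x
    simp [MulAut.mul_apply, MulAut.conj_apply]

/-- The group `Out_c(G) = Aut_c(G) / Inn(G)` of class preserving outer automorphisms. -/
abbrev classPreservingOut (G : Type*) [Group G] : Type _ :=
  classPreservingAut G ⧸ (innerAut G).subgroupOf (classPreservingAut G)

/-- An elementary abelian `p`-group: an abelian group in which every `p`-th power is trivial. -/
def IsElementaryAbelian (p : ℕ) (G : Type*) [Group G] : Prop :=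
  (∀ a b : G, a * b = b * a) ∧ ∀ a : G, a ^ p = 1

/-! Put `n = k + 3`. The quotient `UT_n(K) / γ₃` keeps exactly the first two subdiagonals of a matrix:
the map onto them is a surjective homomorphism to the two-step group `TwoStep k K`, and its kernel
is `γ₃` because that kernel is generated by the elementary matrices `1 + c E_ij` with `i - j ≥ 3`
(`lowerUnitriangular.mem_of_elem_mem`), which are threefold commutators. So all counting happens in
`TwoStep k K`, whose elements are pairs `(a, c)` with `a ∈ K^(k+2)` and `c ∈ K^(k+1)`.

There the conjugates of `(a, c)` are the `(a, c + (b_i a_{i+1} - b_{i+1} a_i)_i)`. A class preserving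
automorphism is therefore a shear `(a, c) ↦ (a, c + f a)` with `f` additive and `f a` of the form
`(b_i a_{i+1} - b_{i+1} a_i)_i` for some `b` depending on `a`; shears compose by adding the maps `f`,
so these automorphisms form an elementary abelian `p`-group.

Testing such an `f` on vectors supported at one index, and at two indices at distance two, gives
`f(a)_i = B_i(a_{i+1}) - B_{i+1}(a_i)` for additive maps `B_0, …, B_{k+1}` of `K`, where
`B_1, …, B_k` are multiplications by scalars (`TwoStep.exists_bracketMap_twist`). Conversely `B_0`
and `B_{k+1}` may be arbitrary additive maps, since `b_0` and `b_{k+1}` each enter only one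
coordinate (`TwoStep.bracketMap_twist_mem`). There are `p^(m²)` additive maps of `K`, hence
`p^(2m² + mk)` class preserving automorphisms. The inner ones correspond to `a ∈ K^(k+2)`, and
`2m² + mk - m(k+2) = 2m(m-1)`. -/

/-! ### The two-step model group -/

/-- The coordinate model of `UT_n(K) / γ₃`, `n = k + 3`: the first subdiagonal `a = sub₁` and the
second subdiagonal `c = sub₂`, with the product
`(a, c) * (a', c') = (a + a', (c_i + c'_i + a_{i+1} a'_i)_i)` inherited from matrices. The pair of
neighbouring indices `(i, i+1)` of `sub₁` is written `(i.castSucc, i.succ)`. -/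
@[ext]
structure TwoStep (k : ℕ) (K : Type*) where
  sub₁ : Fin (k + 2) → K
  sub₂ : Fin (k + 1) → K

namespace TwoStep

variable {k : ℕ} {K : Type*}

section Group

open scoped commutatorElement

variable [CommRing K]

instance : Mul (TwoStep k K) :=
  ⟨fun x y => ⟨x.sub₁ + y.sub₁, fun i => x.sub₂ i + y.sub₂ i + x.sub₁ i.succ * y.sub₁ i.castSucc⟩⟩

instance : One (TwoStep k K) := ⟨⟨0, 0⟩⟩

instance : Inv (TwoStep k K) :=
  ⟨fun x => ⟨-x.sub₁, fun i => -x.sub₂ i + x.sub₁ i.succ * x.sub₁ i.castSucc⟩⟩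

@[simp] theorem mul_sub₁ (x y : TwoStep k K) : (x * y).sub₁ = x.sub₁ + y.sub₁ := rfl

@[simp] theorem mul_sub₂ (x y : TwoStep k K) (i : Fin (k + 1)) :
    (x * y).sub₂ i = x.sub₂ i + y.sub₂ i + x.sub₁ i.succ * y.sub₁ i.castSucc := rfl

@[simp] theorem one_sub₁ : (1 : TwoStep k K).sub₁ = 0 := rfl

@[simp] theorem one_sub₂ : (1 : TwoStep k K).sub₂ = 0 := rfl

@[simp] theorem inv_sub₁ (x : TwoStep k K) : x⁻¹.sub₁ = -x.sub₁ := rfl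

@[simp] theorem inv_sub₂ (x : TwoStep k K) (i : Fin (k + 1)) :
    x⁻¹.sub₂ i = -x.sub₂ i + x.sub₁ i.succ * x.sub₁ i.castSucc := rfl

instance : Group (TwoStep k K) :=
  Group.ofLeftAxioms
    (fun x y z => by ext i <;> simp <;> ring)
    (fun x => by ext i <;> simp)
    (fun x => by ext i <;> simp)

theorem commutator_sub₁ (x y : TwoStep k K) : ⁅x, y⁆.sub₁ = 0 := by
  simp [commutatorElement_def]

theorem mul_comm_of_sub₁_eq_zero {x : TwoStep k K} (hx : x.sub₁ = 0) (y : TwoStep k K) :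
    x * y = y * x := by
  ext i <;> simp [hx, add_comm]

theorem lowerCentralSeries_two_eq_bot :
    (⊤ : Subgroup (TwoStep k K)).lowerCentralSeries 2 = ⊥ := by
  have h1 : (⊤ : Subgroup (TwoStep k K)).lowerCentralSeries 1 ≤ Subgroup.center _ := by
    rw [Subgroup.lowerCentralSeries_succ, Subgroup.lowerCentralSeries_zero,
      Subgroup.commutator_le]
    intro x _ y _
    rw [Subgroup.mem_center_iff]
    exact fun z => (mul_comm_of_sub₁_eq_zero (commutator_sub₁ x y) z).symm
  rw [Subgroup.lowerCentralSeries_succ, eq_bot_iff, Subgroup.commutator_le]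
  intro x hx y _
  rw [Subgroup.mem_bot, commutatorElement_eq_one_iff_mul_comm]
  exact (Subgroup.mem_center_iff.1 (h1 hx) y).symm

/-- The conjugates of `x = (a, c)` are the elements `(a, c + (b_i a_{i+1} - b_{i+1} a_i)_i)`, where
`b` is the first subdiagonal of the inverse of the conjugating element. -/
theorem isConj_iff_exists (x y : TwoStep k K) :
    IsConj x y ↔ y.sub₁ = x.sub₁ ∧ ∃ b : Fin (k + 2) → K, ∀ i : Fin (k + 1),
      y.sub₂ i = x.sub₂ i + (b i.castSucc * x.sub₁ i.succ - b i.succ * x.sub₁ i.castSucc) := by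
  rw [isConj_iff]
  constructor
  · rintro ⟨g, rfl⟩
    refine ⟨by simp, -g.sub₁, fun i => ?_⟩
    simp
    ring
  · rintro ⟨h1, b, hb⟩
    refine ⟨⟨-b, 0⟩, ?_⟩
    ext i
    · simp [h1]
    · simp [hb]
      ring

end Group

/-! ### Class preserving automorphisms as shears -/

section Shear

variable [CommRing K]

/-- The automorphism `(a, c) ↦ (a, c + f a)`. -/
def shear (f : (Fin (k + 2) → K) →+ (Fin (k + 1) → K)) : MulAut (TwoStep k K) where
  toFun x := ⟨x.sub₁, x.sub₂ + f x.sub₁⟩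
  invFun x := ⟨x.sub₁, x.sub₂ - f x.sub₁⟩
  left_inv x := by ext <;> simp
  right_inv x := by ext <;> simp
  map_mul' x y := by
    ext i
    · simp
    · simp
      ring

@[simp] theorem shear_apply (f : (Fin (k + 2) → K) →+ (Fin (k + 1) → K)) (x : TwoStep k K) :
    shear f x = ⟨x.sub₁, x.sub₂ + f x.sub₁⟩ := rfl

theorem shear_add (f g : (Fin (k + 2) → K) →+ (Fin (k + 1) → K)) :
    shear (f + g) = shear f * shear g := by
  ext x i
  · simp
  · simp only [shear_apply, MulAut.mul_apply, AddMonoidHom.add_apply, Pi.add_apply]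
    ring

theorem shear_injective : Function.Injective (shear (k := k) (K := K)) := by
  intro f g h
  refine DFunLike.ext _ _ fun a => ?_
  simpa using congrArg sub₂ (DFunLike.congr_fun h (⟨a, 0⟩ : TwoStep k K))

variable (k K) in
/-- The additive maps `f` such that every `f a` has the form `(b_i a_{i+1} - b_{i+1} a_i)_i`, where
`b` may depend on `a`; if a single `b` works for all `a`, then `shear f` is inner. -/
def pointwiseInner : AddSubgroup ((Fin (k + 2) → K) →+ (Fin (k + 1) → K)) where
  carrier := {f | ∀ a, ∃ b : Fin (k + 2) → K, ∀ i : Fin (k + 1),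
    f a i = b i.castSucc * a i.succ - b i.succ * a i.castSucc}
  zero_mem' a := ⟨0, fun i => by simp⟩
  add_mem' {f g} hf hg a := by
    obtain ⟨b, hb⟩ := hf a
    obtain ⟨b', hb'⟩ := hg a
    refine ⟨b + b', fun i => ?_⟩
    simp only [AddMonoidHom.add_apply, Pi.add_apply, hb, hb']
    ring
  neg_mem' {f} hf a := by
    obtain ⟨b, hb⟩ := hf a
    refine ⟨-b, fun i => ?_⟩
    simp only [AddMonoidHom.neg_apply, Pi.neg_apply, hb]
    ring

theorem shear_mem_classPreservingAut {f : (Fin (k + 2) → K) →+ (Fin (k + 1) → K)} :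
    shear f ∈ classPreservingAut (TwoStep k K) ↔ f ∈ pointwiseInner k K := by
  constructor
  · intro h a
    obtain ⟨-, b, hb⟩ := (isConj_iff_exists _ _).1 (h ⟨a, 0⟩)
    exact ⟨b, fun i => by simpa using hb i⟩
  · intro h x
    obtain ⟨b, hb⟩ := h x.sub₁
    exact (isConj_iff_exists _ _).2 ⟨rfl, b, fun i => by simp [hb]⟩

/-- A class preserving automorphism fixes the first subdiagonal and the central elements `(0, c)`;
hence it is `(a, c) ↦ (a, c + f a)`, and comparing products shows that `f` is additive. -/
theorem exists_shear_eq {α : MulAut (TwoStep k K)} (hα : α ∈ classPreservingAut (TwoStep k K)) :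
    ∃ f, shear f = α := by
  have h1 (x : TwoStep k K) : (α x).sub₁ = x.sub₁ := ((isConj_iff_exists _ _).1 (hα x)).1
  have hfix (c : Fin (k + 1) → K) : α ⟨0, c⟩ = ⟨0, c⟩ := by
    obtain ⟨h, b, hb⟩ := (isConj_iff_exists _ _).1 (hα ⟨0, c⟩)
    ext i
    · rw [h]
    · simpa using hb i
  have hα' (a : Fin (k + 2) → K) (c : Fin (k + 1) → K) :
      (α ⟨a, c⟩).sub₂ = c + (α ⟨a, 0⟩).sub₂ := by
    have h : (⟨a, c⟩ : TwoStep k K) = ⟨0, c⟩ * ⟨a, 0⟩ := by ext i <;> simp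
    rw [h, map_mul, hfix]
    ext i
    simp
  refine ⟨AddMonoidHom.mk' (fun a => (α ⟨a, 0⟩).sub₂) fun a a' => ?_, ?_⟩
  · have h : (⟨a, 0⟩ * ⟨a', 0⟩ : TwoStep k K) =
        ⟨a + a', fun i => a i.succ * a' i.castSucc⟩ := by ext i <;> simp
    have h2 : (α ⟨a, 0⟩ * α ⟨a', 0⟩).sub₂ =
        (fun i => a i.succ * a' i.castSucc) + (α ⟨a + a', 0⟩).sub₂ := by
      rw [← map_mul, h, hα']
    ext i
    have h3 := congrFun h2 i
    simp only [mul_sub₂, h1, Pi.add_apply] at h3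
    rw [Pi.add_apply]
    linear_combination -h3
  · ext x i
    · rw [h1, shear_apply]
    · exact (congrFun (hα' x.sub₁ x.sub₂) i).symm

variable (k K) in
/-- The group of class preserving automorphisms is isomorphic, through `shear`, to the additive
group of pointwise inner maps. -/
noncomputable def pointwiseInnerEquiv :
    Multiplicative (pointwiseInner k K) ≃* classPreservingAut (TwoStep k K) :=
  MulEquiv.ofBijective
    ({ toFun f := ⟨shear f.toAdd.1, shear_mem_classPreservingAut.2 f.toAdd.2⟩
       map_one' := Subtype.ext (MulEquiv.ext fun x => TwoStep.ext rfl (add_zero _))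
       map_mul' f g := Subtype.ext (shear_add f.toAdd.1 g.toAdd.1) } :
      Multiplicative (pointwiseInner k K) →* classPreservingAut (TwoStep k K))
    ⟨fun f g h => Subtype.ext (shear_injective (congrArg Subtype.val h)), fun ⟨α, hα⟩ => by
      obtain ⟨f, rfl⟩ := exists_shear_eq hα
      exact ⟨Multiplicative.ofAdd ⟨f, shear_mem_classPreservingAut.1 hα⟩, rfl⟩⟩

variable (k K) in
/-- Conjugation by `(a, c)` depends only on `a`, and determines it. -/
theorem card_innerAut : Nat.card (innerAut (TwoStep k K)) = Nat.card K ^ (k + 2) := by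
  have hmem (a : Fin (k + 2) → K) : MulAut.conj (⟨a, 0⟩ : TwoStep k K) ∈ innerAut _ := ⟨_, rfl⟩
  have hconj (g x : TwoStep k K) (i : Fin (k + 1)) : (MulAut.conj g x).sub₂ i =
      x.sub₂ i + (g.sub₁ i.succ * x.sub₁ i.castSucc - g.sub₁ i.castSucc * x.sub₁ i.succ) := by
    simp
    ring
  have hbij : Function.Bijective
      (fun a => ⟨_, hmem a⟩ : (Fin (k + 2) → K) → innerAut (TwoStep k K)) := by
    constructor
    · intro a b hab
      have h (v : Fin (k + 2) → K) (i : Fin (k + 1)) :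
          a i.succ * v i.castSucc - a i.castSucc * v i.succ =
            b i.succ * v i.castSucc - b i.castSucc * v i.succ := by
        have := congrArg (fun α => (α.1 (⟨v, 0⟩ : TwoStep k K)).sub₂ i) hab
        simpa only [hconj, Pi.zero_apply, zero_add] using this
      funext j
      induction j using Fin.cases with
      | zero => simpa using h (Pi.single 1 1) 0
      | succ i => simpa [Pi.single_apply, i.castSucc_lt_succ.ne'] using h (Pi.single i.castSucc 1) i
    · rintro ⟨_, g, rfl⟩
      refine ⟨g.sub₁, Subtype.ext (MulEquiv.ext fun x => ?_)⟩
      ext i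
      · simp
      · simp only [hconj]
  rw [← Nat.card_congr (Equiv.ofBijective _ hbij), Nat.card_fun, Nat.card_fin]

end Shear

/-! ### Counting pointwise inner maps -/

section Count

variable [Field K]

/-- The family of additive maps `B_0 = h`, `B_{j+1} = (c_j * ·)` for `j < k`, `B_{k+1} = g`: the
inner indices carry multiplications, the two end indices arbitrary additive maps. -/
def twist (h g : K →+ K) (c : Fin k → K) : Fin (k + 2) → K →+ K :=
  Fin.cons h (Fin.snoc (fun j => AddMonoidHom.mulLeft (c j)) g : Fin (k + 1) → K →+ K)

@[simp] theorem twist_zero (h g : K →+ K) (c : Fin k → K) : twist h g c 0 = h := rfl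

@[simp] theorem twist_last (h g : K →+ K) (c : Fin k → K) :
    twist h g c (Fin.last k).succ = g := by
  simp [twist]

@[simp] theorem twist_succ_castSucc (h g : K →+ K) (c : Fin k → K) (j : Fin k) :
    twist h g c j.castSucc.succ = AddMonoidHom.mulLeft (c j) := by
  simp [twist]

/-- The additive map `a ↦ (B_i(a_{i+1}) - B_{i+1}(a_i))_i` of a family `B` of additive maps. For
multiplications `B_i = (b_i * ·)` this is `a ↦ (b_i a_{i+1} - b_{i+1} a_i)_i`. -/
def bracketMap (B : Fin (k + 2) → K →+ K) : (Fin (k + 2) → K) →+ (Fin (k + 1) → K) where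
  toFun a i := B i.castSucc (a i.succ) - B i.succ (a i.castSucc)
  map_zero' := by ext; simp
  map_add' a b := by
    ext i
    simp
    ring

@[simp] theorem bracketMap_apply (B : Fin (k + 2) → K →+ K) (a : Fin (k + 2) → K)
    (i : Fin (k + 1)) :
    bracketMap B a i = B i.castSucc (a i.succ) - B i.succ (a i.castSucc) := rfl

theorem bracketMap_injective : Function.Injective (bracketMap (k := k) (K := K)) := by
  intro B B' h
  funext j
  ext x
  have h' (v : Fin (k + 2) → K) (i : Fin (k + 1)) := congrFun (DFunLike.congr_fun h v) i
  simp only [bracketMap_apply] at h'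
  induction j using Fin.cases with
  | zero => simpa using h' (Pi.single 1 x) 0
  | succ i => simpa [Pi.single_apply, i.castSucc_lt_succ.ne'] using h' (Pi.single i.castSucc x) i

/-- The index `0` occurs only in the first coordinate of the bracket, and the last index only in the
last one, so that `b_0` and `b_{k+1}` can be adapted to `a` without affecting anything else. -/
theorem bracketMap_twist_mem (h g : K →+ K) (c : Fin k → K) :
    bracketMap (twist h g c) ∈ pointwiseInner k K := by
  intro a
  -- For `x = 0` both sides vanish, whatever value `φ 0 / 0` has.
  have key (φ : K →+ K) (x : K) : φ x = φ x / x * x := by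
    rcases eq_or_ne x 0 with rfl | hx
    · simp
    · rw [div_mul_cancel₀ _ hx]
  refine ⟨Fin.cons (h (a 1) / a 1)
    (Fin.snoc c (g (a (Fin.last k).castSucc) / a (Fin.last k).castSucc) : Fin (k + 1) → K),
    fun i => ?_⟩
  have hl : twist h g c i.castSucc (a i.succ) = (Fin.cons (h (a 1) / a 1)
      (Fin.snoc c (g (a (Fin.last k).castSucc) / a (Fin.last k).castSucc) :
        Fin (k + 1) → K) : Fin (k + 2) → K) i.castSucc * a i.succ := by
    induction i using Fin.cases with
    | zero => exact key _ _
    | succ j => rw [Fin.castSucc_succ]; simp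
  have hr : twist h g c i.succ (a i.castSucc) = (Fin.cons (h (a 1) / a 1)
      (Fin.snoc c (g (a (Fin.last k).castSucc) / a (Fin.last k).castSucc) :
        Fin (k + 1) → K) : Fin (k + 2) → K) i.succ * a i.castSucc := by
    induction i using Fin.lastCases with
    | last => rw [twist_last]; simpa using key _ _
    | cast j => simp
  rw [bracketMap_apply, hl, hr]

/-- The `i`-th coordinate of a pointwise inner map depends only on `a_i` and `a_{i+1}`. Evaluating at
vectors supported at two indices at distance two forces the two maps attached to the index in
between to be multiplications by the same scalar. -/
theorem exists_bracketMap_twist {f : (Fin (k + 2) → K) →+ (Fin (k + 1) → K)}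
    (hf : f ∈ pointwiseInner k K) : ∃ h g c, bracketMap (twist h g c) = f := by
  -- The `i`-th coordinate will be `P i (a_{i+1}) - Q i (a_i)`: `P i` is a candidate for `B_i`, and
  -- `Q i` for `B_{i+1}`.
  let P (i : Fin (k + 1)) : K →+ K :=
    (Pi.evalAddMonoidHom _ i).comp (f.comp (AddMonoidHom.single (fun _ => K) i.succ))
  let Q (i : Fin (k + 1)) : K →+ K :=
    -(Pi.evalAddMonoidHom _ i).comp (f.comp (AddMonoidHom.single (fun _ => K) i.castSucc))
  have hPQ (a : Fin (k + 2) → K) (i : Fin (k + 1)) :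
      f a i = P i (a i.succ) - Q i (a i.castSucc) := by
    have h0 : f (a - Pi.single i.succ (a i.succ) - Pi.single i.castSucc (a i.castSucc)) i = 0 := by
      obtain ⟨b, hb⟩ := hf (a - Pi.single i.succ (a i.succ) - Pi.single i.castSucc (a i.castSucc))
      rw [hb]
      simp [i.castSucc_lt_succ.ne, i.castSucc_lt_succ.ne']
    simp only [map_sub, Pi.sub_apply] at h0
    simp only [P, Q, AddMonoidHom.neg_apply, AddMonoidHom.comp_apply, Pi.evalAddMonoidHom_apply,
      AddMonoidHom.single_apply]
    linear_combination h0
  -- At `a = x e_j + y e_{j+2}` the coordinates `j` and `j + 1` are governed by the same `b_{j+1}`.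
  have hmix (j : Fin k) (x y : K) : ∃ b, Q j.castSucc x = b * x ∧ P j.succ y = b * y := by
    obtain ⟨b, hb⟩ := hf (Pi.single j.castSucc.castSucc x + Pi.single j.succ.succ y)
    have n1 : j.castSucc.succ ≠ j.castSucc.castSucc := by simp [Fin.ext_iff]
    have n2 : j.castSucc.succ ≠ j.succ.succ := by simp [Fin.ext_iff]
    have n3 : j.castSucc.castSucc ≠ j.succ.succ := by simp [Fin.ext_iff]; omega
    have e1 := hb j.castSucc
    have e2 := hb j.succ
    rw [hPQ] at e1 e2
    rw [Fin.castSucc_succ] at e2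
    simp [n1, n2, n3, n3.symm] at e1 e2
    exact ⟨_, e1, e2⟩
  -- Varying one of `x`, `y` and keeping the other equal to `1` gives linearity.
  have hP (j : Fin k) (y : K) : P j.succ y = P j.succ 1 * y := by
    obtain ⟨b, h1, h2⟩ := hmix j 1 y
    obtain ⟨b', h1', h2'⟩ := hmix j 1 1
    rw [h2, h2']
    rw [h1'] at h1
    linear_combination -y * h1
  have hQ (j : Fin k) (x : K) : Q j.castSucc x = P j.succ 1 * x := by
    obtain ⟨b, h1, h2⟩ := hmix j x 1
    rw [h1, h2, mul_one]
  refine ⟨P 0, Q (Fin.last k), fun j => P j.succ 1, ?_⟩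
  refine DFunLike.ext _ _ fun a => funext fun i => ?_
  rw [bracketMap_apply, hPQ]
  congr 1
  · induction i using Fin.cases with
    | zero => simp
    | succ j => rw [Fin.castSucc_succ, twist_succ_castSucc, AddMonoidHom.coe_mulLeft, ← hP]
  · induction i using Fin.lastCases with
    | last => rw [twist_last]
    | cast j => rw [twist_succ_castSucc, AddMonoidHom.coe_mulLeft, ← hQ]

variable (k K) in
theorem card_pointwiseInner :
    Nat.card (pointwiseInner k K) = Nat.card (K →+ K) ^ 2 * Nat.card K ^ k := by
  have hbij : Function.Bijective (fun v : ((K →+ K) × (K →+ K)) × (Fin k → K) =>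
      (⟨bracketMap (twist v.1.1 v.1.2 v.2), bracketMap_twist_mem _ _ _⟩ : pointwiseInner k K)) := by
    constructor
    · rintro ⟨⟨h, g⟩, c⟩ ⟨⟨h', g'⟩, c'⟩ hv
      have hB := bracketMap_injective (congrArg Subtype.val hv)
      have h0 := congrFun hB 0
      have h1 := congrFun hB (Fin.last k).succ
      have h2 : c = c' := by
        funext j
        have := DFunLike.congr_fun (congrFun hB j.castSucc.succ) 1
        simpa using this
      simp only [twist_zero, twist_last] at h0 h1
      rw [h0, h1, h2]
    · rintro ⟨f, hf⟩
      obtain ⟨h, g, c, rfl⟩ := exists_bracketMap_twist hf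
      exact ⟨((h, g), c), rfl⟩
  rw [← Nat.card_congr (Equiv.ofBijective _ hbij), Nat.card_prod, Nat.card_prod, Nat.card_fun,
    Nat.card_fin, sq]

end Count

end TwoStep

namespace lowerUnitriangular

/-! ### Elementary matrices and the lower central series -/

section Generation

variable {n : ℕ} {K : Type*}

variable [CommRing K]

/-- The element of `UT_n(K)` with a given lower unitriangular matrix. -/
noncomputable def ofMatrix (M : Matrix (Fin n) (Fin n) K) (h1 : ∀ i, M i i = 1)
    (h0 : ∀ i j, i < j → M i j = 0) : lowerUnitriangular n K :=
  ⟨Matrix.GeneralLinearGroup.mk'' M (by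
    rw [Matrix.det_of_isLowerTriangular M fun i j hij => h0 i j hij]
    simp [h1]), h1, h0⟩

@[simp] theorem ofMatrix_val (M : Matrix (Fin n) (Fin n) K) (h1 : ∀ i, M i i = 1)
    (h0 : ∀ i j, i < j → M i j = 0) : (ofMatrix M h1 h0).1.1 = M := rfl

theorem ext_val {A B : lowerUnitriangular n K} (h : A.1.1 = B.1.1) : A = B :=
  Subtype.ext (Units.ext h)

theorem apply_self (A : lowerUnitriangular n K) (i : Fin n) : A.1.1 i i = 1 := A.2.1 i

theorem apply_of_lt (A : lowerUnitriangular n K) {i j : Fin n} (h : i < j) : A.1.1 i j = 0 :=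
  A.2.2 i j h

/-- The elementary matrix `1 + c E_ij` with `j < i`, as an element of `UT_n(K)`. -/
noncomputable def elem {i j : Fin n} (hij : j < i) (c : K) : lowerUnitriangular n K :=
  ofMatrix (Matrix.transvection i j c)
    (fun l => by
      have : ¬(i = l ∧ j = l) := fun h => hij.ne (h.2.trans h.1.symm)
      simp [Matrix.transvection, this])
    (fun l l' hl => by
      have : ¬(i = l ∧ j = l') := by rintro ⟨rfl, rfl⟩; exact hl.asymm hij
      simp [Matrix.transvection, this, hl.ne])

@[simp] theorem elem_val {i j : Fin n} (hij : j < i) (c : K) :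
    (elem hij c).1.1 = Matrix.transvection i j c := rfl

/-- `[1 + c E_ij, 1 + E_jl] = 1 + c E_il`. -/
theorem commutator_elem {i j l : Fin n} (hij : j < i) (hjl : l < j) (c : K) :
    elem (hjl.trans hij) c = elem hij c * elem hjl 1 * (elem hij c)⁻¹ * (elem hjl 1)⁻¹ := by
  rw [eq_mul_inv_iff_mul_eq, eq_mul_inv_iff_mul_eq]
  apply ext_val
  have h2 := hjl.ne
  have h3 := (hjl.trans hij).ne
  simp [Matrix.transvection, mul_add, add_mul, h2, h3, Matrix.single_mul_single_of_ne]
  abel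

/-- The lower central series is indexed from `0`, so its term of index `s` contains the elementary
matrices at distance greater than `s` from the diagonal. -/
theorem elem_mem_lowerCentralSeries {i j : Fin n} (s : ℕ) (hij : j.val + s < i.val) (c : K) :
    elem (Fin.lt_def.2 (by omega) : j < i) c ∈
      (⊤ : Subgroup (lowerUnitriangular n K)).lowerCentralSeries s := by
  induction s generalizing i j c with
  | zero => trivial
  | succ s ih =>
    let l : Fin n := ⟨j.val + 1, by omega⟩
    rw [commutator_elem (j := l) (Fin.lt_def.2 (by simp [l]; omega))
      (Fin.lt_def.2 (by simp [l])) c]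
    exact Subgroup.commutator_mem_commutator (ih (by simp [l]; omega) c) trivial

/-- The elementary matrices at distance at least `s` from the diagonal generate the subgroup of
matrices that vanish in between. For the induction on the number of nonzero entries below the
diagonal, take a nonzero entry `(i, j)` in the last column `j` that has one: then column `i` is
trivial, and the column operation by `1 - A_ij E_ij` clears this entry and changes no other. -/
theorem mem_of_elem_mem (H : Subgroup (lowerUnitriangular n K)) (s : ℕ)
    (hH : ∀ (i j : Fin n) (hij : j < i) (c : K), j.val + s ≤ i.val → elem hij c ∈ H)
    (A : lowerUnitriangular n K)
    (hA : ∀ i j : Fin n, j < i → i.val < j.val + s → A.1.1 i j = 0) : A ∈ H := by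
  classical
  induction hN : (Finset.univ.filter fun x : Fin n × Fin n => x.2 < x.1 ∧ A.1.1 x.1 x.2 ≠ 0).card
    using Nat.strong_induction_on generalizing A with
  | _ N ih =>
  by_cases hne : ∃ j i : Fin n, j < i ∧ A.1.1 i j ≠ 0
  swap
  · push Not at hne
    have : A = 1 := by
      apply ext_val
      ext i j
      rcases lt_trichotomy i j with h | rfl | h
      · rw [apply_of_lt A h]; simp [h.ne]
      · rw [apply_self]; simp
      · rw [hne j i h]; simp [h.ne']
    rw [this]
    exact one_mem H
  obtain ⟨j, ⟨i, hji, hij0⟩, hmax⟩ := (Set.toFinite {j : Fin n | ∃ i, j < i ∧ A.1.1 i j ≠ 0}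
    ).exists_maximal hne
  have hcol (l : Fin n) (hl : i < l) : A.1.1 l i = 0 := by
    by_contra h
    exact (hmax ⟨l, hl, h⟩ hji.le).not_gt hji
  have hs : j.val + s ≤ i.val := by
    by_contra h
    exact hij0 (hA i j hji (by omega))
  have hent (x y : Fin n) (hxy : y < x) : (A * elem hji (-A.1.1 i j)).1.1 x y =
      if x = i ∧ y = j then 0 else A.1.1 x y := by
    change (A.1.1 * Matrix.transvection i j (-A.1.1 i j)) x y = _
    by_cases hy : y = j
    · subst hy
      rw [Matrix.mul_transvection_apply_same]
      rcases lt_trichotomy x i with h | rfl | h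
      · simp [apply_of_lt A h, h.ne]
      · simp [apply_self]
      · simp [hcol x h, h.ne']
    · rw [Matrix.mul_transvection_apply_of_ne _ _ _ _ hy]
      simp [hy]
  have hmem : A * elem hji (-A.1.1 i j) ∈ H := by
    refine ih _ ?_ _ (fun x y hxy hx => ?_) rfl
    · rw [← hN]
      apply Finset.card_lt_card
      rw [Finset.ssubset_iff_of_subset]
      · refine ⟨(i, j), by simp [hji, hij0], ?_⟩
        simp only [Finset.mem_filter, not_and, not_not]
        intro _ _
        rw [hent _ _ hji]
        simp
      · intro x hx
        simp only [Finset.mem_filter, Finset.mem_univ, true_and] at hx ⊢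
        refine ⟨hx.1, fun h => hx.2 ?_⟩
        rw [hent _ _ hx.1, h, ite_self]
    · rw [hent _ _ hxy, hA x y hxy hx, ite_self]
  exact (Subgroup.mul_mem_cancel_right H (hH _ _ hji _ hs)).1 hmem

end Generation

/-! ### The quotient by the third term of the lower central series -/

section Quotient

variable {k : ℕ} {K : Type*}

variable [CommRing K]

theorem mul_apply_sub₁ (A B : lowerUnitriangular (k + 3) K) (j : Fin (k + 2)) :
    (A * B).1.1 j.succ j.castSucc = A.1.1 j.succ j.castSucc + B.1.1 j.succ j.castSucc := by
  change (A.1.1 * B.1.1) _ _ = _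
  rw [Matrix.mul_apply, Finset.sum_eq_add j.castSucc j.succ j.castSucc_lt_succ.ne]
  · rw [apply_self, apply_self, mul_one, one_mul]
  · rintro l - ⟨h1, h2⟩
    rcases lt_or_gt_of_ne h1 with h | h
    · rw [apply_of_lt B h, mul_zero]
    · rw [apply_of_lt A, zero_mul]
      simp only [Fin.lt_def, ne_eq, Fin.ext_iff, Fin.val_castSucc, Fin.val_succ] at *
      omega
  · simp
  · simp

theorem mul_apply_sub₂ (A B : lowerUnitriangular (k + 3) K) (i : Fin (k + 1)) :
    (A * B).1.1 i.succ.succ i.castSucc.castSucc =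
      A.1.1 i.succ.succ i.castSucc.castSucc + B.1.1 i.succ.succ i.castSucc.castSucc +
        A.1.1 i.succ.succ i.succ.castSucc * B.1.1 i.castSucc.succ i.castSucc.castSucc := by
  change (A.1.1 * B.1.1) _ _ = _
  have n1 : i.castSucc.castSucc ≠ i.succ.succ := by simp [Fin.ext_iff]; omega
  have n2 : i.castSucc.castSucc ≠ i.castSucc.succ := by simp [Fin.ext_iff]
  have n3 : i.succ.succ ≠ i.castSucc.succ := by simp [Fin.ext_iff]
  rw [Matrix.mul_apply, ← Finset.sum_subset
    (Finset.subset_univ {i.castSucc.castSucc, i.succ.succ, i.castSucc.succ})]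
  · rw [Finset.sum_insert (by simp [n1, n2]), Finset.sum_pair n3, apply_self, apply_self, mul_one,
      one_mul, ← add_assoc, Fin.succ_castSucc]
  · intro l _ hl
    simp only [Finset.mem_insert, Finset.mem_singleton, not_or] at hl
    obtain ⟨h1, h2, h3⟩ := hl
    rcases lt_or_gt_of_ne h1 with h | h
    · rw [apply_of_lt B h, mul_zero]
    · rw [apply_of_lt A, zero_mul]
      simp only [Fin.lt_def, ne_eq, Fin.ext_iff, Fin.val_castSucc, Fin.val_succ] at *
      omega

variable (k K) in
/-- The homomorphism that reads off the first two subdiagonals. -/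
def toTwoStep : lowerUnitriangular (k + 3) K →* TwoStep k K :=
  MonoidHom.mk' (fun A => ⟨fun j => A.1.1 j.succ j.castSucc,
    fun i => A.1.1 i.succ.succ i.castSucc.castSucc⟩) fun A B =>
      TwoStep.ext (funext fun j => mul_apply_sub₁ A B j) (funext fun i => mul_apply_sub₂ A B i)

theorem toTwoStep_sub₁ (A : lowerUnitriangular (k + 3) K) (j : Fin (k + 2)) :
    (toTwoStep k K A).sub₁ j = A.1.1 j.succ j.castSucc := rfl

theorem toTwoStep_sub₂ (A : lowerUnitriangular (k + 3) K) (i : Fin (k + 1)) :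
    (toTwoStep k K A).sub₂ i = A.1.1 i.succ.succ i.castSucc.castSucc := rfl

theorem toTwoStep_surjective : Function.Surjective (toTwoStep k K) := by
  intro x
  let M : Matrix (Fin (k + 3)) (Fin (k + 3)) K := fun i j =>
    if i = j then 1
    else if h : i.val = j.val + 1 then x.sub₁ ⟨j.val, by omega⟩
    else if h : i.val = j.val + 2 then x.sub₂ ⟨j.val, by omega⟩ else 0
  refine ⟨ofMatrix M (fun i => if_pos rfl) (fun i j hij => ?_), ?_⟩
  · have h1 : ¬i.val = j.val + 1 := by rw [Fin.lt_def] at hij; omega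
    have h2 : ¬i.val = j.val + 2 := by rw [Fin.lt_def] at hij; omega
    simp [M, hij.ne, h1, h2]
  · ext j
    · rw [toTwoStep_sub₁, ofMatrix_val]
      simp [M, Fin.ext_iff]
    · rw [toTwoStep_sub₂, ofMatrix_val]
      simp [M, Fin.ext_iff, add_assoc]

theorem ker_toTwoStep :
    (toTwoStep k K).ker = (⊤ : Subgroup (lowerUnitriangular (k + 3) K)).lowerCentralSeries 2 := by
  apply le_antisymm
  · intro A hA
    refine mem_of_elem_mem _ 3 (fun i j hij c h => elem_mem_lowerCentralSeries 2 (by omega) c) A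
      fun i j hij hi => ?_
    rw [MonoidHom.mem_ker] at hA
    rw [Fin.lt_def] at hij
    have h2 : i.val = j.val + 1 ∨ i.val = j.val + 2 := by omega
    rcases h2 with h | h
    · have hs := congrFun (congrArg TwoStep.sub₁ hA) ⟨j.val, by omega⟩
      rw [toTwoStep_sub₁] at hs
      rw [show i = Fin.succ ⟨j.val, by omega⟩ from Fin.ext h]
      exact hs
    · have hs := congrFun (congrArg TwoStep.sub₂ hA) ⟨j.val, by omega⟩
      rw [toTwoStep_sub₂] at hs
      rw [show i = Fin.succ (Fin.succ ⟨j.val, by omega⟩) from Fin.ext h]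
      exact hs
  · rw [← Subgroup.map_eq_bot_iff, Subgroup.map_lowerCentralSeries, eq_bot_iff,
      ← TwoStep.lowerCentralSeries_two_eq_bot,
      Subgroup.map_top_of_surjective _ toTwoStep_surjective]

variable (k K) in
/-- The isomorphism of `UT_n(K) / γ₃` with the two-step model, `n = k + 3`. -/
noncomputable def quotientEquiv : UTModGamma3 (k + 3) K ≃* TwoStep k K :=
  (QuotientGroup.quotientMulEquivOfEq ker_toTwoStep.symm).trans
    (QuotientGroup.quotientKerEquivOfSurjective _ toTwoStep_surjective)

end Quotient

end lowerUnitriangular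

/-! ### Transport along isomorphisms, and orders -/

section Transport

variable {G H : Type*} [Group G] [Group H]

theorem classPreservingAut_map_congr (e : G ≃* H) :
    (classPreservingAut G).map (MulAut.congr e : MulAut G →* MulAut H) = classPreservingAut H := by
  ext β
  constructor
  · rintro ⟨α, hα, rfl⟩ x
    have h := (e : G →* H).map_isConj (hα (e.symm x))
    simpa using h
  · intro hβ
    refine ⟨(MulAut.congr e).symm β, fun x => ?_, (MulAut.congr e).apply_symm_apply β⟩
    have h := (e.symm : H →* G).map_isConj (hβ (e x))
    simpa using h

theorem innerAut_map_congr (e : G ≃* H) :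
    (innerAut G).map (MulAut.congr e : MulAut G →* MulAut H) = innerAut H := by
  have key (g : G) : MulAut.congr e (MulAut.conj g) = MulAut.conj (e g) := by
    ext x
    simp
  ext β
  constructor
  · rintro ⟨_, ⟨g, rfl⟩, rfl⟩
    exact ⟨e g, (key g).symm⟩
  · rintro ⟨h, rfl⟩
    refine ⟨_, ⟨e.symm h, rfl⟩, ?_⟩
    simpa using key (e.symm h)

/-- Isomorphic groups have isomorphic groups of class preserving automorphisms. -/
noncomputable def classPreservingAutCongr (e : G ≃* H) :
    classPreservingAut G ≃* classPreservingAut H :=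
  ((classPreservingAut G).equivMapOfInjective _ (MulAut.congr e).injective).trans
    (MulEquiv.subgroupCongr (classPreservingAut_map_congr e))

theorem card_innerAut_congr (e : G ≃* H) : Nat.card (innerAut G) = Nat.card (innerAut H) := by
  rw [← innerAut_map_congr e]
  exact Nat.card_congr ((innerAut G).equivMapOfInjective _ (MulAut.congr e).injective).toEquiv

variable (G) in
theorem card_classPreservingOut_mul_card_innerAut :
    Nat.card (classPreservingOut G) * Nat.card (innerAut G) = Nat.card (classPreservingAut G) := by
  rw [Subgroup.card_eq_card_quotient_mul_card_subgroup
    ((innerAut G).subgroupOf (classPreservingAut G)),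
    Nat.card_congr (Subgroup.subgroupOfEquivOfLe (innerAut_le_classPreservingAut G)).toEquiv]

end Transport

/-- Additive endomorphisms of `K` are linear over the prime field, over which `K` has dimension
`m`. -/
theorem card_addMonoidHom_self {p m : ℕ} [Fact p.Prime] {K : Type*} [Field K] [CharP K p]
    (hK : Nat.card K = p ^ m) : Nat.card (K →+ K) = p ^ m ^ 2 := by
  let _ := ZMod.algebra K p
  have hfin : Finite K := Nat.finite_of_card_ne_zero (by
    rw [hK]
    exact pow_ne_zero _ (Fact.out : p.Prime).ne_zero)
  have hrank : Module.finrank (ZMod p) K = m := by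
    have h := Module.natCard_eq_pow_finrank (K := ZMod p) (V := K)
    rw [hK, Nat.card_zmod] at h
    exact (Nat.pow_right_injective (Fact.out : p.Prime).two_le h).symm
  rw [Nat.card_congr (AddMonoidHom.toZModLinearMapEquiv p (M := K) (M₁ := K)).toEquiv,
    Module.natCard_eq_pow_finrank (K := ZMod p), Nat.card_zmod, Module.finrank_linearMap, hrank, sq]

theorem theorem4 (p m n : ℕ) (hp : p.Prime) (hm : 1 ≤ m) (hn : 3 ≤ n)
    (K : Type*) [Field K] (hK : Nat.card K = p ^ m) :
    IsElementaryAbelian p (classPreservingAut (UTModGamma3 n K)) ∧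
    Nat.card (classPreservingAut (UTModGamma3 n K)) = p ^ (2 * m ^ 2 + m * n - 3 * m) ∧
    Nat.card (classPreservingOut (UTModGamma3 n K)) = p ^ (2 * m * (m - 1)) := by
  obtain ⟨k, rfl⟩ := Nat.exists_eq_add_of_le' hn
  have : Fact p.Prime := ⟨hp⟩
  have hfin : Finite K := Nat.finite_of_card_ne_zero (by rw [hK]; exact pow_ne_zero _ hp.ne_zero)
  have hchar : CharP K p := by
    have := Fintype.ofFinite K
    exact charP_of_card_eq_prime_pow (Nat.card_eq_fintype_card.symm.trans hK)
  let e := lowerUnitriangular.quotientEquiv k K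
  let Φ := (classPreservingAutCongr e).trans (TwoStep.pointwiseInnerEquiv k K).symm
  have hAut : Nat.card (classPreservingAut (UTModGamma3 (k + 3) K)) = p ^ (2 * m ^ 2 + m * k) := by
    rw [Nat.card_congr Φ.toEquiv, Nat.card_congr Multiplicative.toAdd, TwoStep.card_pointwiseInner,
      card_addMonoidHom_self hK, hK, ← pow_mul, ← pow_mul, ← pow_add, mul_comm (m ^ 2)]
  refine ⟨⟨fun a b => Φ.injective ?_, fun a => Φ.injective ?_⟩, ?_, ?_⟩
  · rw [map_mul, map_mul, mul_comm]
  · rw [map_pow, map_one]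
    refine Subtype.ext (DFunLike.ext _ _ fun a => funext fun i => ?_)
    change (p • ((Φ _).toAdd.1 : (Fin (k + 2) → K) →+ (Fin (k + 1) → K))) a i = 0
    simp
  · rw [hAut]
    congr 1
    rw [mul_add, mul_comm m 3, ← add_assoc, Nat.add_sub_cancel]
  · have h := card_classPreservingOut_mul_card_innerAut (UTModGamma3 (k + 3) K)
    rw [hAut, card_innerAut_congr e, TwoStep.card_innerAut, hK, ← pow_mul] at h
    apply Nat.eq_of_mul_eq_mul_right (pow_pos hp.pos (m * (k + 2)))
    rw [h, ← pow_add]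
    congr 1
    obtain ⟨r, rfl⟩ := Nat.exists_eq_add_of_le' hm
    rw [Nat.add_sub_cancel]
    ring
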